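/- Let $G_1, G_2$ be nontrivial groups which are not both isomorphic to $\mathbb{Z}/2\mathbb{Z}$, let $G = G_1 * G_2$ be their free product, and let $\mathbb{F}_\omega$ be the free group with basis $e_1, e_2, e_3, \ldots$. Let $\varphi_{\mathrm{NE}}(x,y)$ be the first-order formula $$\forall u\,\forall v\;\bigl([u,v] \neq 1 \rightarrow xy \neq u^5 v^4\bigr)$$ in the language of groups. Then for any pair $(a,b)$ of distinct elements which is part of some basis of $\mathbb{F}_\omega$ we have $$G * \mathbb{F}_\omega \models \varphi_{\mathrm{NE}}(a,b).$$ Moreover, $e_1 \neq u^5 v^4$ for all non-commuting elements $u, v$ of $G * \mathbb{F}_\omega$. -/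

import Mathlib

open FirstOrder FirstOrder.Language
open scoped commutatorElement

namespace NonEq

/-- Function symbols of the first-order language of groups: a constant `1`, a unary symbol for
inversion and a binary symbol for multiplication. -/
inductive GroupFunc : ℕ → Type
  | one : GroupFunc 0
  | inv : GroupFunc 1
  | mul : GroupFunc 2

/-- The first-order language of groups (no relation symbols besides equality). -/
def groupLang : Language where
  Functions := GroupFunc
  Relations := fun _ => Empty

/-- Every group is a structure for the language of groups in the usual way. -/
instance groupStructure (Γ : Type*) [Group Γ] : groupLang.Structure Γ where
  funMap {n} (f : GroupFunc n) :=
    match n, f with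
    | _, .one => fun _ => 1
    | _, .inv => fun x => (x 0)⁻¹
    | _, .mul => fun x => x 0 * x 1
  RelMap {_} r := Empty.elim r

/-- The constant term `1`. -/
def tOne {α : Type*} : groupLang.Term α := Term.func (l := 0) GroupFunc.one ![]

/-- The term `t⁻¹`. -/
def tInv {α : Type*} (t : groupLang.Term α) : groupLang.Term α :=
  Term.func (l := 1) GroupFunc.inv ![t]

/-- The term `s * t`. -/
def tMul {α : Type*} (s t : groupLang.Term α) : groupLang.Term α :=
  Term.func (l := 2) GroupFunc.mul ![s, t]

/-- The term `t ^ n`, that is `1 * t * ⋯ * t` with `n` factors `t`. -/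
def tPow {α : Type*} (t : groupLang.Term α) : ℕ → groupLang.Term α
  | 0 => tOne
  | n + 1 => tMul (tPow t n) t

/-- The term `[s, t] = s * t * s⁻¹ * t⁻¹`. -/
def tComm {α : Type*} (s t : groupLang.Term α) : groupLang.Term α :=
  tMul (tMul (tMul s t) (tInv s)) (tInv t)

/-- The first-order formula `φ_NE(x, y) := ∀ u v, ([u, v] ≠ 1 → x * y ≠ u ^ 5 * v ^ 4)` in the
language of groups; its free variables `x, y` are indexed by `0, 1 : Fin 2`, and `u, v` are the
bound variables `&0, &1`. -/
def phiNE : groupLang.Formula (Fin 2) :=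
  let x : groupLang.Term (Fin 2 ⊕ Fin 2) := Term.var (Sum.inl 0)
  let y : groupLang.Term (Fin 2 ⊕ Fin 2) := Term.var (Sum.inl 1)
  let u : groupLang.Term (Fin 2 ⊕ Fin 2) := &0
  let v : groupLang.Term (Fin 2 ⊕ Fin 2) := &1
  ((Term.bdEqual (tComm u v) tOne).not.imp
    (Term.bdEqual (tMul x y) (tMul (tPow u 5) (tPow v 4))).not).all.all

section Realize

variable {Γ : Type*} [Group Γ] {α : Type*} (w : α → Γ)

@[simp] lemma realize_tOne : (tOne : groupLang.Term α).realize w = 1 := rfl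

@[simp] lemma realize_tInv (t : groupLang.Term α) :
    (tInv t).realize w = (t.realize w)⁻¹ := rfl

@[simp] lemma realize_tMul (s t : groupLang.Term α) :
    (tMul s t).realize w = s.realize w * t.realize w := rfl

@[simp] lemma realize_tPow (t : groupLang.Term α) (n : ℕ) :
    (tPow t n).realize w = (t.realize w) ^ n := by
  induction n with
  | zero => simp [tPow]
  | succ n ih => simp [tPow, ih, pow_succ]

@[simp] lemma realize_tComm (s t : groupLang.Term α) :
    (tComm s t).realize w = ⁅s.realize w, t.realize w⁆ := by
  simp [tComm, commutatorElement_def]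

end Realize

/-- The formula `φ_NE` means what it should in every group. -/
lemma realize_phiNE {Γ : Type*} [Group Γ] (a b : Γ) :
    phiNE.Realize ![a, b] ↔ ∀ u v : Γ, ⁅u, v⁆ ≠ 1 → a * b ≠ u ^ 5 * v ^ 4 := by
  simp [phiNE, Formula.Realize, Fin.snoc]

/-- `F_ω`, the free group of rank `ω`, on the basis `e_1, e_2, …`. -/
abbrev FOmega : Type := FreeGroup ℕ

/-- The first element `e_1` of the fixed basis `e_1, e_2, …` of `F_ω`
(the basis is indexed from `0` here). -/
def e₁ : FOmega := FreeGroup.of 0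

/-- The pair `(a, b)` is part of some basis of the free group `F`: `a` and `b` are two members,
with different indices, of one basis. -/
def IsPartOfBasis {F : Type*} [Group F] (a b : F) : Prop :=
  ∃ (S : Set F) (B : FreeGroupBasis S F), (∀ s : S, B s = (s : F)) ∧ a ∈ S ∧ b ∈ S ∧ a ≠ b

/-- Any two members with different indices of an indexed basis are part of a basis. -/
lemma IsPartOfBasis.of_basis {F : Type*} [Group F] {ι : Type*} (B : FreeGroupBasis ι F)
    {i j : ι} (hij : i ≠ j) : IsPartOfBasis (B i) (B j) := by
  refine ⟨Set.range B, B.reindex (Equiv.ofInjective B B.injective), ?_, ⟨i, rfl⟩, ⟨j, rfl⟩,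
    fun h => hij (B.injective h)⟩
  rintro ⟨_, k, rfl⟩
  rw [FreeGroupBasis.reindex_apply]
  congr 1
  exact Equiv.ofInjective_symm_apply B.injective k

end NonEq

/-!
Let `F` be free on a basis containing `e`, let `K = G * F`, and let `K` permute by left translations
the basis of a free group of rank `|K|`. The semidirect product `Γ` of these two groups retracts
onto `K` and contains a copy of `K` in which `e` is a basis element of the free factor. Moreover `Γ`
acts on the Cayley tree of that free factor with trivial edge stabilisers, and the sum of exponents
`τ : Γ → ℤ` vanishes on vertex stabilisers, while `τ e = 1`.

Suppose `e = u ^ m * v ^ n` with `m, n ≥ 4`. Comparing exponent sums, `τ u ≠ 0` and `τ v ≠ 0`, so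
both elements are hyperbolic. As `e` moves the base vertex `o` to a neighbour, the geodesics from
`o` to `u ^ (-m) • o` and to `v ^ n • o` agree up to one edge. Each of them runs to an axis, along
it for `m` or `n` periods, and then away from it again. Either the axes overlap in more than the sum
of their periods, so that the commutator of `u` and `v` fixes an edge, or one of the powers, say
`r`, reverses a period of the axis of the other element, say `h`, so that `r⁻¹ * h * r * h` fixes a
vertex. The latter contradicts `τ h ≠ 0`.

A product `a * b` of two members of a basis reduces to the case of a single one, since replacing `a`
by `a * b` yields another basis.
-/

namespace NonEq

/-- The vertex set of a simplicial tree, encoded by its path metric: an integral geodesic metric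
satisfying the four-point condition. The field `even_perimeter` says that the graph is bipartite;
without it, every connected graph whose blocks are complete graphs would qualify. -/
structure TreeMetric (X : Type*) where
  dist : X → X → ℕ
  dist_self (x : X) : dist x x = 0
  dist_comm (x y : X) : dist x y = dist y x
  eq_of_dist_eq_zero {x y : X} : dist x y = 0 → x = y
  four_point (x y z w : X) :
    dist x z + dist y w ≤ max (dist x y + dist z w) (dist x w + dist y z)
  even_perimeter (x y z : X) : Even (dist x y + dist y z + dist x z)
  exists_between (x y : X) {i : ℕ} : i ≤ dist x y → ∃ z, dist x z = i ∧ i + dist z y = dist x y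

namespace TreeMetric

variable {X : Type*} (T : TreeMetric X)

lemma dist_triangle (x y z : X) : T.dist x z ≤ T.dist x y + T.dist y z := by
  have hfour := T.four_point x y z y
  rw [T.dist_self, T.dist_comm z y] at hfour
  omega

variable {T} in
lemma dist_pos {x y : X} (h : x ≠ y) : 0 < T.dist x y :=
  Nat.pos_of_ne_zero fun hzero => h (T.eq_of_dist_eq_zero hzero)

/-- The vertex `y` lies on the geodesic from `x` to `z`. -/
def Between (x y z : X) : Prop := T.dist x y + T.dist y z = T.dist x z

/-- The vertex `w` is the one at distance `i` from `x` on the geodesic from `x` to `y`. -/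
def OnGeodesic (x y : X) (i : ℕ) (w : X) : Prop := T.dist x w = i ∧ T.Between x w y

variable {T}

lemma Between.symm {x y z : X} (h : T.Between x y z) : T.Between z y x := by
  unfold Between at *
  rw [T.dist_comm z y, T.dist_comm y x, T.dist_comm z x, add_comm, h]

lemma between_self_left (x y : X) : T.Between x x y := by
  rw [Between, T.dist_self, zero_add]

lemma between_self_right (x y : X) : T.Between x y y := by
  rw [Between, T.dist_self, add_zero]

lemma Between.concat {p x y z : X} (h : T.Between p x y) (h' : T.Between x y z) (hxy : x ≠ y) :
    T.Between p y z := by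
  have hpos := dist_pos (T := T) hxy
  have hfour := T.four_point p x y z
  have htri := T.dist_triangle p y z
  unfold Between at *
  omega

lemma exists_between_both_of_dist_le_one (o : X) {p q : X} (h : T.dist p q ≤ 1) :
    ∃ y, T.Between o p y ∧ T.Between o q y := by
  have heven := T.even_perimeter o p q
  have htri := T.dist_triangle o p q
  have htri' := T.dist_triangle o q p
  have hcomm := T.dist_comm p q
  rcases le_total (T.dist o p) (T.dist o q) with hle | hle
  · refine ⟨q, ?_, between_self_right o q⟩
    unfold Between
    grind
  · refine ⟨p, between_self_right o p, ?_⟩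
    unfold Between
    grind

lemma exists_onGeodesic {x y : X} {i : ℕ} (hi : i ≤ T.dist x y) : ∃ w, T.OnGeodesic x y i w := by
  obtain ⟨w, rfl, hw⟩ := T.exists_between x y hi
  exact ⟨w, rfl, hw⟩

namespace OnGeodesic

variable {x y : X} {i j : ℕ}

lemma add_dist {w w' : X} (hij : i ≤ j) (h : T.OnGeodesic x y i w) (h' : T.OnGeodesic x y j w') :
    i + T.dist w w' = j := by
  obtain ⟨rfl, hw⟩ := h
  obtain ⟨rfl, hw'⟩ := h'
  have hfour := T.four_point w x w' y
  have htri := T.dist_triangle x w w'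
  unfold Between at *
  rw [T.dist_comm w x] at hfour
  omega

lemma unique {w w' : X} (h : T.OnGeodesic x y i w) (h' : T.OnGeodesic x y i w') : w = w' :=
  T.eq_of_dist_eq_zero (by have := h.add_dist le_rfl h'; omega)

lemma of_between {a b w : X} (ha : T.OnGeodesic x y i a) (hb : T.OnGeodesic x y j b)
    (h : i + T.dist a w + T.dist w b = j) : T.OnGeodesic x y (i + T.dist a w) w := by
  obtain ⟨rfl, ha⟩ := ha
  obtain ⟨rfl, hb⟩ := hb
  have hxaw := T.dist_triangle x a w
  have hwby := T.dist_triangle w b y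
  have hxwy := T.dist_triangle x w y
  unfold Between at *
  constructor
  · omega
  · unfold Between
    omega

end OnGeodesic

end TreeMetric

/-- An action of the group `Γ` by automorphisms on a tree with vertex set `X`. -/
structure TreeAction (Γ X : Type*) [Group Γ] [MulAction Γ X] extends TreeMetric X where
  dist_smul (g : Γ) (x y : X) : dist (g • x) (g • y) = dist x y

/-- The automorphism `g` of a tree with vertex set `X` is hyperbolic: it fixes no vertex and
inverts no edge. As an automorphism whose square fixes a vertex does one or the other, this is
a condition on the square only. -/
def IsHyperbolic {Γ : Type*} (X : Type*) [SMul Γ X] (g : Γ) : Prop := ∀ x : X, g • g • x ≠ x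

namespace TreeAction

open TreeMetric

variable {Γ X : Type*} [Group Γ] [MulAction Γ X]

section Axis

variable {T : TreeAction Γ X}

lemma between_smul_iff (g : Γ) {x y z : X} :
    T.Between (g • x) (g • y) (g • z) ↔ T.Between x y z := by
  simp only [Between, T.dist_smul]

lemma dist_inv_smul_self (g : Γ) (x : X) : T.dist x (g⁻¹ • x) = T.dist x (g • x) := by
  rw [← T.dist_smul g, smul_inv_smul, T.dist_comm]

lemma between_smul_smul_of_displacement_min {g : Γ} (hg : IsHyperbolic X g) {z : X}
    (hmin : ∀ w, T.dist z (g • z) ≤ T.dist w (g • w)) : T.Between z (g • z) (g • g • z) := by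
  -- Otherwise `g` moves the neighbour `w` of `z` in the direction of `g • z` less far than `z`.
  by_contra hne
  unfold Between at hne
  have hpos : 0 < T.dist z (g • g • z) := dist_pos (hg z).symm
  have hstep : T.dist (g • z) (g • g • z) = T.dist z (g • z) := T.dist_smul g _ _
  have htri := T.dist_triangle z (g • z) (g • g • z)
  obtain ⟨k, hk⟩ := T.even_perimeter z (g • z) (g • g • z)
  obtain ⟨w, hzw, hwgz⟩ := T.exists_between z (g • z) (i := 1) (by omega)
  have hgz_gw : T.dist (g • z) (g • w) = 1 := by rw [T.dist_smul, hzw]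
  have hgw_ggz : T.dist (g • w) (g • g • z) = T.dist w (g • z) := T.dist_smul g _ _
  have hfour_ggz := T.four_point (g • w) (g • z) z (g • g • z)
  have hfour_gw := T.four_point w z (g • w) (g • z)
  have hmin_w := hmin w
  rw [T.dist_comm (g • w) (g • z), T.dist_comm (g • w) z, T.dist_comm (g • z) z] at hfour_ggz
  rw [T.dist_comm w z, T.dist_comm (g • w) (g • z)] at hfour_gw
  omega

lemma between_smul_of_displacement_min_of_nearest {g : Γ} {o z : X} (hz : z ≠ g • z)
    (hmin : ∀ w, T.dist z (g • z) ≤ T.dist w (g • w))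
    (hnear : ∀ w, T.dist w (g • w) = T.dist z (g • z) → T.dist o z ≤ T.dist o w) :
    T.Between o z (g • z) := by
  -- Otherwise `g` moves the neighbour `w` of `z` in the direction of `g • z` at most as far as `z`,
  -- and `w` is closer to `o`.
  by_contra hne
  unfold Between at hne
  have hpos := dist_pos (T := T.toTreeMetric) hz
  have htri := T.dist_triangle o z (g • z)
  obtain ⟨k, hk⟩ := T.even_perimeter o z (g • z)
  obtain ⟨w, hzw, hwgz⟩ := T.exists_between z (g • z) (i := 1) (by omega)
  have hfour := T.four_point w z o (g • z)
  have hgz_gw : T.dist (g • z) (g • w) = 1 := by rw [T.dist_smul, hzw]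
  have hdisp := T.dist_triangle w (g • z) (g • w)
  have hmin_w := hmin w
  have hnear_w := hnear w (by omega)
  rw [T.dist_comm w z, T.dist_comm w o, T.dist_comm z o] at hfour
  omega

variable (T) in
/-- The vertex `z` is the one nearest to `o` on the axis of the hyperbolic automorphism `g`. -/
structure IsAxisFoot (g : Γ) (o z : X) : Prop where
  ne_smul : z ≠ g • z
  between_smul : T.Between z (g • z) (g • g • z)
  between_left : T.Between o z (g • z)
  between_right : T.Between z (g • z) (g • o)

lemma exists_isAxisFoot {g : Γ} (hg : IsHyperbolic X g) (o : X) : ∃ z, T.IsAxisFoot g o z := by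
  let displacement : X → ℕ := fun w => T.dist w (g • w)
  have : Nonempty X := ⟨o⟩
  obtain ⟨z, hmin, hnear⟩ : ∃ z, (∀ w, displacement z ≤ displacement w) ∧
      ∀ w, displacement w = displacement z → T.dist o z ≤ T.dist o w := by
    let z₀ := Function.argmin displacement
    have hne : {w | displacement w = displacement z₀}.Nonempty := ⟨z₀, rfl⟩
    have hz := Function.argminOn_mem (T.dist o) _ hne
    refine ⟨Function.argminOn (T.dist o) _ hne, fun w => ?_, fun w hw => ?_⟩
    · exact hz.trans_le (Function.argmin_le displacement w)
    · exact Function.argminOn_le (T.dist o) _ (hw.trans hz)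
  have hz : z ≠ g • z := fun h => hg z (by rw [← h, ← h])
  have hback : T.Between o z (g⁻¹ • z) := by
    refine between_smul_of_displacement_min_of_nearest (fun h => hz ?_) ?_ ?_
    · rwa [eq_inv_smul_iff, eq_comm] at h
    · simpa only [dist_inv_smul_self] using hmin
    · simpa only [dist_inv_smul_self] using hnear
  refine ⟨z, hz, between_smul_smul_of_displacement_min hg hmin,
    between_smul_of_displacement_min_of_nearest hz hmin hnear, Between.symm ?_⟩
  rwa [← between_smul_iff g, smul_inv_smul] at hback

namespace IsAxisFoot

variable {g : Γ} {o z : X} (h : T.IsAxisFoot g o z)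
include h

lemma between_pow_smul {p : X} (hp : T.Between p z (g • z)) (n : ℕ) :
    T.Between p (g ^ n • z) (g ^ (n + 1) • z) := by
  induction n with
  | zero => simpa using hp
  | succ n ih =>
    refine ih.concat ?_ ?_
    · simpa only [pow_succ, mul_smul, between_smul_iff] using h.between_smul
    · simpa only [pow_succ, mul_smul, ne_eq, smul_left_cancel_iff] using h.ne_smul

lemma dist_pow_smul {p : X} (hp : T.Between p z (g • z)) (n : ℕ) :
    T.dist p (g ^ n • z) = T.dist p z + n * T.dist z (g • z) := by
  induction n with
  | zero => simp
  | succ n ih =>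
    rw [← h.between_pow_smul hp n, ih, pow_succ, mul_smul, T.dist_smul]
    ring

lemma dist_pow_succ_smul_base {p : X} (hp : T.Between p z (g • z)) (n : ℕ) :
    T.dist p (g ^ (n + 1) • o) = T.dist p z + (n + 1) * T.dist z (g • z) + T.dist o z := by
  have hright : T.Between (g ^ n • z) (g ^ (n + 1) • z) (g ^ (n + 1) • o) := by
    simpa only [pow_succ, mul_smul, between_smul_iff] using h.between_right
  have hne : g ^ n • z ≠ g ^ (n + 1) • z := by
    simpa only [pow_succ, mul_smul, ne_eq, smul_left_cancel_iff] using h.ne_smul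
  rw [← (h.between_pow_smul hp n).concat hright hne, h.dist_pow_smul hp, T.dist_smul,
    T.dist_comm z o]

lemma dist_base_pow_smul_base {k : ℕ} (hk : k ≠ 0) :
    T.dist o (g ^ k • o) = k * T.dist z (g • z) + 2 * T.dist o z := by
  obtain ⟨n, rfl⟩ := Nat.exists_eq_succ_of_ne_zero hk
  rw [Nat.succ_eq_add_one, h.dist_pow_succ_smul_base h.between_left]
  ring

lemma dist_foot_pow_smul_base (k : ℕ) :
    T.dist z (g ^ k • o) = k * T.dist z (g • z) + T.dist o z := by
  rcases k with _ | n
  · simp [T.dist_comm]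
  · rw [h.dist_pow_succ_smul_base (between_self_left _ _), T.dist_self, zero_add]

end IsAxisFoot

end Axis

variable (T : TreeAction Γ X)

/-- The automorphism `g` moves the part of the geodesic from `o` to `y` between the distances `s`
and `e` from `o` by `L` along this geodesic, as far as it does not leave this part. -/
def TranslatesSegment (g : Γ) (o y : X) (L s e : ℕ) : Prop :=
  ∀ ⦃i w⦄, s ≤ i → i + L ≤ e → T.OnGeodesic o y i w → T.OnGeodesic o y (i + L) (g • w)

/-- The automorphism `r` maps the initial part of length `a` of the geodesic from `o` to `y` into
this geodesic, reversing its direction and taking `o` to the vertex at distance `N` from `o`. -/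
def ReversesInitialSegment (r : Γ) (o y : X) (a N : ℕ) : Prop :=
  ∀ ⦃i j w⦄, i ≤ a → i + j = N → T.OnGeodesic o y i w → T.OnGeodesic o y j (r • w)

variable {T} {g h : Γ} {o y z : X}

lemma TranslatesSegment.mono {L s s' e e' : ℕ} (hg : T.TranslatesSegment g o y L s e)
    (hs : s ≤ s') (he : e' ≤ e) : T.TranslatesSegment g o y L s' e' :=
  fun _ _ hi hi' => hg (hs.trans hi) (hi'.trans he)

namespace IsAxisFoot

variable (hz : T.IsAxisFoot g o z) {k : ℕ} (hk : k ≠ 0) (hy : T.Between o (g ^ k • o) y)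
include hz hk hy

lemma onGeodesic_pow_smul_base :
    T.OnGeodesic o y (k * T.dist z (g • z) + 2 * T.dist o z) (g ^ k • o) :=
  ⟨hz.dist_base_pow_smul_base hk, hy⟩

lemma onGeodesic_pow_smul {j : ℕ} (hj : j ≤ k) :
    T.OnGeodesic o y (T.dist o z + j * T.dist z (g • z)) (g ^ j • z) := by
  obtain ⟨m, rfl⟩ := Nat.exists_eq_add_of_le hj
  have hstart : T.OnGeodesic o y 0 o := ⟨T.dist_self o, between_self_left o y⟩
  have hleft := hz.dist_pow_smul hz.between_left j
  have hright : T.dist (g ^ j • z) (g ^ (j + m) • o) = m * T.dist z (g • z) + T.dist o z := by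
    rw [pow_add, mul_smul, T.dist_smul, hz.dist_foot_pow_smul_base]
  have hjz := hstart.of_between (hz.onGeodesic_pow_smul_base hk hy) (w := g ^ j • z)
    (by rw [hleft, hright]; ring)
  rwa [zero_add, hleft] at hjz

lemma translatesSegment : T.TranslatesSegment g o y (T.dist z (g • z))
    (T.dist o z) (T.dist o z + k * T.dist z (g • z)) := by
  intro i w hi hi' hw
  obtain ⟨m, rfl⟩ := Nat.exists_eq_succ_of_ne_zero hk
  have hfoot := hz.onGeodesic_pow_smul hk hy (Nat.zero_le _)
  have hnext := hz.onGeodesic_pow_smul hk hy (j := 1) (by omega)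
  have hprev := hz.onGeodesic_pow_smul hk hy (Nat.le_succ m)
  have hlast := hz.onGeodesic_pow_smul hk hy le_rfl
  simp only [pow_zero, one_smul, zero_mul, add_zero, pow_one, one_mul] at hfoot hnext
  rw [Nat.succ_mul] at hi' hlast
  have hzw := hfoot.add_dist hi hw
  have hwm := hw.add_dist (by omega) hprev
  have hgw := hnext.of_between hlast (w := g • w) (by
    rw [pow_succ', mul_smul, T.dist_smul, T.dist_smul]
    omega)
  rw [T.dist_smul] at hgw
  convert hgw using 1
  omega

lemma reversesInitialSegment : T.ReversesInitialSegment (g ^ k) o y (T.dist o z)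
    (k * T.dist z (g • z) + 2 * T.dist o z) := by
  intro i j w hi hij hw
  have hfoot := hz.onGeodesic_pow_smul hk hy (Nat.zero_le _)
  have hlast := hz.onGeodesic_pow_smul hk hy le_rfl
  simp only [pow_zero, one_smul, zero_mul, add_zero] at hfoot
  have hwz := hw.add_dist hi hfoot
  have how : T.dist w o = i := (T.dist_comm w o).trans hw.1
  have hgw := hlast.of_between (hz.onGeodesic_pow_smul_base hk hy) (w := g ^ k • w) (by
    rw [T.dist_smul, T.dist_smul, T.dist_comm z w, how]
    omega)
  rw [T.dist_smul, T.dist_comm z w] at hgw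
  convert hgw using 1
  omega

end IsAxisFoot

lemma commute_of_translatesSegment
    (hfree : ∀ (k : Γ) (x x' : X), k • x = x → k • x' = x' → x ≠ x' → k = 1) {L L' s e : ℕ}
    (hg : T.TranslatesSegment g o y L s e) (hh : T.TranslatesSegment h o y L' s e)
    (hse : s + L + L' + 1 ≤ e) (he : e ≤ T.dist o y) : Commute g h := by
  have hcomm : ∀ ⦃i w⦄, s ≤ i → i + L + L' ≤ e → T.OnGeodesic o y i w →
      ((h * g)⁻¹ * (g * h)) • w = w := by
    intro i w hi hi' hw
    have hgh := hg (by omega) (by omega) (hh hi (by omega) hw)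
    have hhg := hh (by omega) (by omega) (hg hi (by omega) hw)
    rw [Nat.add_right_comm] at hgh
    rw [mul_smul, inv_smul_eq_iff, mul_smul, mul_smul, hgh.unique hhg]
  obtain ⟨w, hw⟩ := exists_onGeodesic (T := T.toTreeMetric) (x := o) (y := y) (i := s) (by omega)
  obtain ⟨w', hw'⟩ :=
    exists_onGeodesic (T := T.toTreeMetric) (x := o) (y := y) (i := s + 1) (by omega)
  have hww' : w ≠ w' := by
    rintro rfl
    exact absurd (hw.1.symm.trans hw'.1) (by omega)
  exact (inv_mul_eq_one.mp (hfree _ w w' (hcomm le_rfl (by omega) hw)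
    (hcomm (by omega) (by omega) hw') hww')).symm

lemma exists_smul_smul_smul_eq_of_reverses {r : Γ} {L s e a N : ℕ}
    (hh : T.TranslatesSegment h o y L s e) (hr : T.ReversesInitialSegment r o y a N)
    (hsa : s + L ≤ a) (hae : a ≤ e) (hsN : s + a ≤ N) (hNe : N + L ≤ e + a)
    (hN : N ≤ T.dist o y) : ∃ w : X, h • r • h • w = r • w := by
  obtain ⟨w, hw⟩ :=
    exists_onGeodesic (T := T.toTreeMetric) (x := o) (y := y) (i := a - L) (by omega)
  have hhw := hh (by omega) (by omega) hw
  have hrhw := hr (by omega) (show a - L + L + (N - a) = N by omega) hhw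
  have hhrhw := hh (by omega) (by omega) hrhw
  exact ⟨w, hhrhw.unique (hr (by omega) (by omega) hw)⟩

section Character

variable {A : Type*} [CommGroup A] [IsMulTorsionFree A] {τ : Γ →* A}
  (hτ : ∀ (k : Γ) (x : X), k • x = x → τ k = 1)
include hτ

lemma isHyperbolic_of_map_ne_one (hg : τ g ≠ 1) : IsHyperbolic X g := by
  intro x hx
  have hsq := hτ (g ^ 2) x (by rwa [pow_two, mul_smul])
  rw [map_pow] at hsq
  exact hg (sq_eq_one.mp hsq)

lemma not_reversesInitialSegment (hτh : τ h ≠ 1) {r : Γ} {L s e a N : ℕ}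
    (hh : T.TranslatesSegment h o y L s e) (hsa : s + L ≤ a) (hae : a ≤ e) (hsN : s + a ≤ N)
    (hNe : N + L ≤ e + a) (hN : N ≤ T.dist o y) : ¬ T.ReversesInitialSegment r o y a N := by
  intro hr
  obtain ⟨w, hw⟩ := exists_smul_smul_smul_eq_of_reverses hh hr hsa hae hsN hNe hN
  have hsq : τ (r⁻¹ * (h * (r * h))) = τ h ^ 2 := by
    simp only [map_mul, map_inv, pow_two]
    rw [mul_left_comm (τ h), inv_mul_cancel_left]
  refine hτh (sq_eq_one.mp ?_)
  rw [← hsq]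
  exact hτ _ w (by simp only [mul_smul, hw, inv_smul_smul])

/-- If neither of the geodesics from `o` to `g ^ m • o` and to `h ^ n • o` reverses a period of the
other axis, then the axes overlap in more than the sum of the two periods. -/
lemma commute_of_dist_pow_smul_le_one
    (hfree : ∀ (k : Γ) (x x' : X), k • x = x → k • x' = x' → x ≠ x' → k = 1)
    (hτg : τ g ≠ 1) (hτh : τ h ≠ 1) {m n : ℕ} (hm : 4 ≤ m) (hn : 4 ≤ n)
    (hdist : T.dist (g ^ m • o) (h ^ n • o) ≤ 1) : Commute g h := by
  have hm0 : m ≠ 0 := by omega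
  have hn0 : n ≠ 0 := by omega
  obtain ⟨y, hgy, hhy⟩ := exists_between_both_of_dist_le_one o hdist
  obtain ⟨z, hz⟩ := T.exists_isAxisFoot (isHyperbolic_of_map_ne_one hτ hτg) o
  obtain ⟨z', hz'⟩ := T.exists_isAxisFoot (isHyperbolic_of_map_ne_one hτ hτh) o
  have hgrev := hz.reversesInitialSegment hm0 hgy
  have hhrev := hz'.reversesInitialSegment hn0 hhy
  have hgtrans := hz.translatesSegment hm0 hgy
  have hhtrans := hz'.translatesSegment hn0 hhy
  have hglen := hz.dist_base_pow_smul_base hm0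
  have hhlen := hz'.dist_base_pow_smul_base hn0
  have hL := dist_pos (T := T.toTreeMetric) hz.ne_smul
  have hL' := dist_pos (T := T.toTreeMetric) hz'.ne_smul
  have hmL := Nat.mul_le_mul_right (T.dist z (g • z)) hm
  have hnL' := Nat.mul_le_mul_right (T.dist z' (h • z')) hn
  have htri := T.dist_triangle o (g ^ m • o) (h ^ n • o)
  have htri' := T.dist_triangle o (h ^ n • o) (g ^ m • o)
  rw [T.dist_comm (h ^ n • o)] at htri'
  unfold Between at hgy hhy
  generalize T.dist z (g • z) = L at *
  generalize T.dist z' (h • z') = L' at *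
  generalize T.dist o z = a at *
  generalize T.dist o z' = b at *
  by_cases hg_rev : b + L' ≤ a ∧ m * L + a + L' ≤ n * L' + b
  · exact absurd hgrev (not_reversesInitialSegment hτ hτh hhtrans (by omega) (by omega) (by omega)
      (by omega) (by omega))
  by_cases hh_rev : a + L ≤ b ∧ n * L' + b + L ≤ m * L + a
  · exact absurd hhrev (not_reversesInitialSegment hτ hτg hgtrans (by omega) (by omega) (by omega)
      (by omega) (by omega))
  exact commute_of_translatesSegment hfree
    (hgtrans.mono (le_max_left a b) (min_le_left _ (b + n * L')))
    (hhtrans.mono (le_max_right a b) (min_le_right (a + m * L) _)) (by omega) (by omega)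

theorem commute_of_dist_pow_mul_pow_smul_le_one
    (hfree : ∀ (k : Γ) (x x' : X), k • x = x → k • x' = x' → x ≠ x' → k = 1)
    (hτg : τ g ≠ 1) (hτh : τ h ≠ 1) {m n : ℕ} (hm : 4 ≤ m) (hn : 4 ≤ n)
    (hdist : T.dist o ((g ^ m * h ^ n) • o) ≤ 1) : Commute g h := by
  rw [← T.dist_smul (g ^ m)⁻¹, mul_smul, inv_smul_smul, ← inv_pow] at hdist
  exact Commute.inv_left_iff.mp
    (commute_of_dist_pow_smul_le_one hτ hfree (by rwa [map_inv, inv_ne_one]) hτh hm hn hdist)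

end Character

end TreeAction

section CayleyTree

open FreeGroup

lemma exists_maximal_common_prefix {α : Type*} (l l' : List α) :
    ∃ p a b, l = p ++ a ∧ l' = p ++ b ∧ ∀ c ∈ a.head?, ∀ d ∈ b.head?, c ≠ d := by
  induction l generalizing l' with
  | nil => exact ⟨[], [], l', rfl, rfl, by simp⟩
  | cons c l ih =>
    match l' with
    | [] => exact ⟨[], c :: l, [], rfl, rfl, by simp⟩
    | d :: l' =>
      by_cases hcd : c = d
      · obtain ⟨p, a, b, rfl, rfl, hab⟩ := ih l'
        exact ⟨c :: p, a, b, rfl, by rw [hcd, List.cons_append], hab⟩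
      · exact ⟨[], c :: l, d :: l', rfl, rfl, by simpa using hcd⟩

variable {ι : Type*}

lemma mk_append_inv_mul_mk_append (p a b : List (ι × Bool)) :
    (mk (p ++ a))⁻¹ * mk (p ++ b) = mk (invRev a ++ b) := by
  simp only [← mul_mk, ← inv_mk]
  group

lemma isReduced_invRev_append {a b : List (ι × Bool)} (ha : IsReduced a) (hb : IsReduced b)
    (hab : ∀ c ∈ a.head?, ∀ d ∈ b.head?, c ≠ d) : IsReduced (invRev a ++ b) := by
  classical
  have ha' : IsReduced (invRev a) := by
    rw [isReduced_iff_reduce_eq, reduce_invRev, ha.reduce_eq]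
  refine List.isChain_append.mpr ⟨ha', hb, fun c hc d hd hcd => ?_⟩
  simp only [invRev, List.getLast?_reverse, List.head?_map, Option.mem_def,
    Option.map_eq_some_iff] at hc
  obtain ⟨c, hc, rfl⟩ := hc
  exact Bool.not_eq.mpr fun h => hab c hc d hd (Prod.ext hcd h)

variable [DecidableEq ι]

lemma exists_take_toWord_eq_and_norm_inv_mul (x y : FreeGroup ι) :
    ∃ n ≤ x.norm, n ≤ y.norm ∧ x.toWord.take n = y.toWord.take n ∧
      (x⁻¹ * y).norm + 2 * n = x.norm + y.norm := by
  obtain ⟨p, a, b, hx, hy, hab⟩ := exists_maximal_common_prefix x.toWord y.toWord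
  have ha : IsReduced a := isReduced_toWord.infix (hx ▸ (List.suffix_append p a).isInfix)
  have hb : IsReduced b := isReduced_toWord.infix (hy ▸ (List.suffix_append p b).isInfix)
  have hword : (x⁻¹ * y).toWord = invRev a ++ b := by
    rw [← mk_toWord (x := x), ← mk_toWord (x := y), hx, hy, mk_append_inv_mul_mk_append,
      toWord_mk, (isReduced_invRev_append ha hb hab).reduce_eq]
  have hnx : x.norm = p.length + a.length := by rw [FreeGroup.norm, hx, List.length_append]
  have hny : y.norm = p.length + b.length := by rw [FreeGroup.norm, hy, List.length_append]
  refine ⟨p.length, by omega, by omega, by rw [hx, hy, List.take_left, List.take_left], ?_⟩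
  rw [hnx, hny, FreeGroup.norm, hword, List.length_append, invRev_length]
  ring

lemma norm_inv_mul_le_of_take_toWord_eq {x y : FreeGroup ι} {n : ℕ} (hx : n ≤ x.norm)
    (hy : n ≤ y.norm) (hxy : x.toWord.take n = y.toWord.take n) :
    (x⁻¹ * y).norm + 2 * n ≤ x.norm + y.norm := by
  have hmk : x⁻¹ * y = mk (invRev (x.toWord.drop n) ++ y.toWord.drop n) := by
    rw [← mk_append_inv_mul_mk_append (x.toWord.take n), List.take_append_drop, hxy,
      List.take_append_drop, mk_toWord, mk_toWord]
  have hle := norm_mk_le (L₁ := invRev (x.toWord.drop n) ++ y.toWord.drop n)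
  rw [← hmk, List.length_append, invRev_length, List.length_drop, List.length_drop] at hle
  unfold FreeGroup.norm at *
  omega

lemma norm_four_point (x y z : FreeGroup ι) :
    (x⁻¹ * z).norm + y.norm ≤ max ((x⁻¹ * y).norm + z.norm) (x.norm + (y⁻¹ * z).norm) := by
  obtain ⟨n, hnx, -, hxy, hn⟩ := exists_take_toWord_eq_and_norm_inv_mul x y
  obtain ⟨n', -, hnz', hyz, hn'⟩ := exists_take_toWord_eq_and_norm_inv_mul y z
  have hxz : x.toWord.take (min n n') = z.toWord.take (min n n') := by
    rw [min_comm, ← List.take_take, hxy, List.take_take, min_comm, ← List.take_take, hyz,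
      List.take_take]
  have hle := norm_inv_mul_le_of_take_toWord_eq (by omega) (by omega) hxz
  omega

variable (ι) in
/-- The Cayley tree of the free group on `ι` with respect to its free basis. -/
def cayleyTree : TreeMetric (FreeGroup ι) where
  dist x y := (x⁻¹ * y).norm
  dist_self x := by rw [inv_mul_cancel, FreeGroup.norm_one]
  dist_comm x y := by rw [← norm_inv_eq, mul_inv_rev, inv_inv]
  eq_of_dist_eq_zero h := inv_mul_eq_one.mp (norm_eq_zero.mp h)
  four_point x y z w := by
    have h := norm_four_point (w⁻¹ * x) (w⁻¹ * y) (w⁻¹ * z)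
    have hcomm (t : FreeGroup ι) : (t⁻¹ * w).norm = (w⁻¹ * t).norm := by
      rw [← norm_inv_eq, mul_inv_rev, inv_inv]
    simpa only [mul_inv_rev, inv_inv, mul_assoc, mul_inv_cancel_left, hcomm] using h
  even_perimeter x y z := by
    obtain ⟨_, -, -, -, hxy⟩ := exists_take_toWord_eq_and_norm_inv_mul x y
    obtain ⟨_, -, -, -, hyz⟩ := exists_take_toWord_eq_and_norm_inv_mul y z
    obtain ⟨_, -, -, -, hxz⟩ := exists_take_toWord_eq_and_norm_inv_mul x z
    grind
  exists_between x y i hi := by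
    have hred (l : List (ι × Bool)) (hl : l <:+: (x⁻¹ * y).toWord) : (mk l).norm = l.length := by
      rw [FreeGroup.norm, toWord_mk, (isReduced_toWord.infix hl).reduce_eq]
    have htake := hred _ (List.take_prefix i _).isInfix
    have hdrop := hred _ (List.drop_suffix i _).isInfix
    refine ⟨x * mk ((x⁻¹ * y).toWord.take i), ?_, ?_⟩
    · rw [inv_mul_cancel_left, htake, List.length_take, ← FreeGroup.norm, min_eq_left hi]
    · have hrest : (x * mk ((x⁻¹ * y).toWord.take i))⁻¹ * y = mk ((x⁻¹ * y).toWord.drop i) := by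
        rw [mul_inv_rev, mul_assoc, inv_mul_eq_iff_eq_mul, mul_mk, List.take_append_drop,
          mk_toWord]
      rw [hrest, hdrop, List.length_drop, ← FreeGroup.norm]
      exact Nat.add_sub_cancel' hi

lemma cayleyTree_dist (x y : FreeGroup ι) : (cayleyTree ι).dist x y = (x⁻¹ * y).norm := rfl

end CayleyTree

section AffineAction

open scoped SemidirectProduct

variable {N H : Type*} [Group N] [Group H] {φ : H →* MulAut N}

/-- The affine action of a semidirect product on its normal factor: this factor acts by left
translations, its complement by the given automorphisms. -/
instance semidirectProductMulAction : MulAction (N ⋊[φ] H) N where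
  smul g x := g.left * φ g.right x
  one_smul x := by
    change (1 : N ⋊[φ] H).left * φ (1 : N ⋊[φ] H).right x = x
    simp
  mul_smul g h x := by
    change (g * h).left * φ (g * h).right x = g.left * φ g.right (h.left * φ h.right x)
    simp [mul_assoc]

lemma semidirectProduct_smul_def (g : N ⋊[φ] H) (x : N) : g • x = g.left * φ g.right x := rfl

lemma inv_smul_mul_smul (g : N ⋊[φ] H) (x y : N) :
    (g • x)⁻¹ * g • y = φ g.right (x⁻¹ * y) := by
  simp only [semidirectProduct_smul_def, map_mul, map_inv]
  group

lemma inl_smul (g : N ⋊[φ] H) (x : N) :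
    (SemidirectProduct.inl (g • x) : N ⋊[φ] H) =
      g * SemidirectProduct.inl x * (SemidirectProduct.inr g.right)⁻¹ := by
  ext <;> simp [semidirectProduct_smul_def]

end AffineAction

section PermutedBasis

open FreeGroup (of mk_toWord toWord_mk IsReduced isReduced_toWord)
open SemidirectProduct (inl)
open scoped SemidirectProduct

/-- The action of `H` on the free group on `ι` that permutes the basis as `H` permutes `ι`. -/
def permuteBasis (H ι : Type*) [Group H] [MulAction H ι] : H →* MulAut (FreeGroup ι) where
  toFun h := FreeGroup.freeGroupCongr (MulAction.toPerm h)
  map_one' := by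
    rw [MulAction.toPerm_one]
    exact FreeGroup.freeGroupCongr_refl
  map_mul' h h' := by
    rw [MulAut.mul_def, FreeGroup.freeGroupCongr_trans]
    congr 1
    ext i
    exact mul_smul h h' i

variable {H ι : Type*} [Group H] [MulAction H ι]

lemma permuteBasis_of (h : H) (i : ι) : permuteBasis H ι h (of i) = of (h • i) := rfl

lemma toWord_permuteBasis [DecidableEq ι] (h : H) (x : FreeGroup ι) :
    (permuteBasis H ι h x).toWord = x.toWord.map fun c => (h • c.1, c.2) := by
  have hred : IsReduced (x.toWord.map fun c => (h • c.1, c.2)) :=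
    (List.isChain_map _).mpr
      (isReduced_toWord.imp fun c d hcd heq => hcd (smul_left_cancel h heq))
  rw [← hred.reduce_eq, ← toWord_mk]
  nth_rewrite 1 [← mk_toWord (x := x)]
  rfl

lemma norm_permuteBasis [DecidableEq ι] (h : H) (x : FreeGroup ι) :
    (permuteBasis H ι h x).norm = x.norm := by
  rw [FreeGroup.norm, toWord_permuteBasis, List.length_map, FreeGroup.norm]

lemma eq_one_of_permuteBasis_eq_self [IsCancelSMul H ι] {h : H} {x : FreeGroup ι} (hx : x ≠ 1)
    (hfix : permuteBasis H ι h x = x) : h = 1 := by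
  classical
  obtain ⟨c, l, hword⟩ := List.exists_cons_of_ne_nil (mt FreeGroup.toWord_eq_nil_iff.mp hx)
  have hmap := toWord_permuteBasis h x
  rw [hfix, hword, List.map_cons, List.cons_eq_cons] at hmap
  have hc : c.1 = h • c.1 := congrArg Prod.fst hmap.1
  exact IsCancelSMul.right_cancel h 1 c.1 (by rw [← hc, one_smul])

lemma eq_one_of_smul_eq_self_of_ne [IsCancelSMul H ι] (k : FreeGroup ι ⋊[permuteBasis H ι] H)
    (x x' : FreeGroup ι) (hx : k • x = x) (hx' : k • x' = x') (hne : x ≠ x') : k = 1 := by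
  have hfix := inv_smul_mul_smul k x x'
  rw [hx, hx'] at hfix
  have hright := eq_one_of_permuteBasis_eq_self (mt inv_mul_eq_one.mp hne) hfix.symm
  rw [semidirectProduct_smul_def, hright, map_one, MulAut.one_apply, mul_eq_right] at hx
  exact SemidirectProduct.ext hx hright

variable (H ι)

/-- The extension by `H` of the free group on `ι` whose basis `H` permutes, acting on the Cayley
tree. -/
def cayleyTreeAction [DecidableEq ι] :
    TreeAction (FreeGroup ι ⋊[permuteBasis H ι] H) (FreeGroup ι) where
  toTreeMetric := cayleyTree ι
  dist_smul g x y := by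
    rw [cayleyTree_dist, cayleyTree_dist, inv_smul_mul_smul, norm_permuteBasis]

/-- The sum of the exponents of the basis elements in an element of the extension by `H` of the
free group on `ι` whose basis `H` permutes. -/
def exponentSum : FreeGroup ι ⋊[permuteBasis H ι] H →* Multiplicative ℤ :=
  SemidirectProduct.lift (FreeGroup.lift fun _ => Multiplicative.ofAdd 1) 1 fun h => by
    ext i
    simp [permuteBasis_of]

variable {H ι}

lemma exponentSum_inl_of (i : ι) : exponentSum H ι (inl (of i)) = Multiplicative.ofAdd 1 := by
  rw [exponentSum, SemidirectProduct.lift_inl, FreeGroup.lift_apply_of]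

lemma exponentSum_eq_one_of_smul_eq_self (k : FreeGroup ι ⋊[permuteBasis H ι] H) (x : FreeGroup ι)
    (hx : k • x = x) : exponentSum H ι k = 1 := by
  have hinl := congrArg (exponentSum H ι) (inl_smul k x)
  have hinr : exponentSum H ι (SemidirectProduct.inr k.right) = 1 :=
    SemidirectProduct.lift_inr ..
  rwa [hx, map_mul, map_mul, map_inv, hinr, inv_one, mul_one, right_eq_mul] at hinl

lemma ofAdd_one_ne_pow {m : ℕ} (hm : m ≠ 1) (c : Multiplicative ℤ) :
    Multiplicative.ofAdd 1 ≠ c ^ m := by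
  intro h
  have hmul : 1 = m * c.toAdd := by simpa using congrArg Multiplicative.toAdd h
  have hdvd : (m : ℤ) ∣ 1 := ⟨_, hmul⟩
  exact hm (by exact_mod_cast Int.eq_one_of_dvd_one m.cast_nonneg hdvd)

theorem commute_of_inl_of_eq_pow_mul_pow [IsCancelSMul H ι] {m n : ℕ} (hm : 4 ≤ m) (hn : 4 ≤ n)
    {i : ι} {u v : FreeGroup ι ⋊[permuteBasis H ι] H} (h : inl (of i) = u ^ m * v ^ n) :
    Commute u v := by
  classical
  have hτ := congrArg (exponentSum H ι) h
  rw [exponentSum_inl_of, map_mul, map_pow, map_pow] at hτ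
  have hτu : exponentSum H ι u ≠ 1 := fun hu =>
    ofAdd_one_ne_pow (m := n) (by omega) _ (by rwa [hu, one_pow, one_mul] at hτ)
  have hτv : exponentSum H ι v ≠ 1 := fun hv =>
    ofAdd_one_ne_pow (m := m) (by omega) _ (by rwa [hv, one_pow, mul_one] at hτ)
  have hdist : (cayleyTreeAction H ι).dist 1 ((u ^ m * v ^ n) • 1) = 1 := by
    rw [← h, semidirectProduct_smul_def, map_one, mul_one, SemidirectProduct.left_inl]
    change (1⁻¹ * of i).norm = 1
    rw [inv_one, one_mul, FreeGroup.norm_of]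
  exact TreeAction.commute_of_dist_pow_mul_pow_smul_le_one exponentSum_eq_one_of_smul_eq_self
    eq_one_of_smul_eq_self_of_ne hτu hτv hm hn hdist.le

end PermutedBasis

section FreeProduct

open FreeGroup (of)
open SemidirectProduct (inl inr)
open scoped SemidirectProduct

variable {ι F : Type*} [Group F]

lemma freeGroupBasis_lift_apply {H : Type*} [Group H] (B : FreeGroupBasis ι F) (f : ι → H)
    (i : ι) : B.lift f (B i) = f i :=
  congrFun (B.lift.symm_apply_apply f) i

/-- The retraction that substitutes `e` for the basis element `of 1`, and hence `h * e * h⁻¹` for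
the basis element `of h`. -/
def conjugateSubstitution {K : Type*} [Group K] (e : K) :
    FreeGroup K ⋊[permuteBasis K K] K →* K :=
  SemidirectProduct.lift (FreeGroup.lift fun h => h * e * h⁻¹) (MonoidHom.id K) fun h => by
    ext h'
    simp [permuteBasis_of, mul_assoc]

variable (G : Type*) [Group G]

open Classical in
/-- The embedding of `G * F` that replaces the basis element `B i` of `F` by a new free generator,
whose conjugates by `G * F` are the other members of the permuted basis. -/
noncomputable def freeingHom (B : FreeGroupBasis ι F) (i : ι) : Monoid.Coprod G F →*
    FreeGroup (Monoid.Coprod G F) ⋊[permuteBasis (Monoid.Coprod G F) (Monoid.Coprod G F)]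
      Monoid.Coprod G F :=
  Monoid.Coprod.lift (inr.comp Monoid.Coprod.inl)
    (B.lift (Function.update (fun k => inr (Monoid.Coprod.inr (B k))) i (inl (of 1))))

variable {G}

lemma freeingHom_inr_self (B : FreeGroupBasis ι F) (i : ι) :
    freeingHom G B i (Monoid.Coprod.inr (B i)) = inl (of 1) := by
  classical
  rw [freeingHom, Monoid.Coprod.lift_apply_inr, freeGroupBasis_lift_apply, Function.update_self]

lemma freeingHom_inr_of_ne (B : FreeGroupBasis ι F) {i k : ι} (hk : k ≠ i) :
    freeingHom G B i (Monoid.Coprod.inr (B k)) = inr (Monoid.Coprod.inr (B k)) := by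
  classical
  rw [freeingHom, Monoid.Coprod.lift_apply_inr, freeGroupBasis_lift_apply,
    Function.update_of_ne hk]

lemma conjugateSubstitution_comp_freeingHom (B : FreeGroupBasis ι F) (i : ι) :
    (conjugateSubstitution (Monoid.Coprod.inr (B i))).comp (freeingHom G B i) =
      MonoidHom.id (Monoid.Coprod G F) := by
  refine Monoid.Coprod.hom_ext ?_ (B.ext_hom _ _ fun k => ?_)
  · ext x
    simp [freeingHom, conjugateSubstitution]
  · by_cases hk : k = i
    · subst hk
      simp [freeingHom_inr_self, conjugateSubstitution]
    · simp [freeingHom_inr_of_ne B hk, conjugateSubstitution]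

lemma freeingHom_injective (B : FreeGroupBasis ι F) (i : ι) :
    Function.Injective (freeingHom G B i) :=
  Function.LeftInverse.injective (g := conjugateSubstitution (Monoid.Coprod.inr (B i)))
    (DFunLike.congr_fun (conjugateSubstitution_comp_freeingHom B i))

theorem commute_of_inr_basis_eq_pow_mul_pow {m n : ℕ} (hm : 4 ≤ m) (hn : 4 ≤ n)
    (B : FreeGroupBasis ι F) (i : ι) {u v : Monoid.Coprod G F}
    (h : Monoid.Coprod.inr (B i) = u ^ m * v ^ n) : Commute u v := by
  have hmap := congrArg (freeingHom G B i) h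
  rw [freeingHom_inr_self, map_mul, map_pow, map_pow] at hmap
  exact (commute_of_inl_of_eq_pow_mul_pow hm hn hmap).of_map (freeingHom_injective B i)

lemma exists_basis_apply_eq_mul (B : FreeGroupBasis ι F) {i j : ι} (hij : i ≠ j) :
    ∃ B' : FreeGroupBasis ι F, B' i = B i * B j := by
  classical
  let transvection (x : F) : F →* F := B.lift (Function.update B i (B i * x))
  have apply_self (x : F) : transvection x (B i) = B i * x := by
    simp only [transvection, freeGroupBasis_lift_apply, Function.update_self]
  have apply_of_ne (x : F) {k : ι} (hk : k ≠ i) : transvection x (B k) = B k := by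
    simp only [transvection, freeGroupBasis_lift_apply, Function.update_of_ne hk]
  have comp_eq_id {x y : F} (hxy : x * y = 1) (hfix : transvection x y = y) :
      (transvection x).comp (transvection y) = MonoidHom.id F := by
    refine B.ext_hom _ _ fun k => ?_
    by_cases hk : k = i
    · rw [hk, MonoidHom.comp_apply, apply_self, map_mul, apply_self, hfix, mul_assoc, hxy,
        mul_one, MonoidHom.id_apply]
    · rw [MonoidHom.comp_apply, apply_of_ne _ hk, apply_of_ne _ hk, MonoidHom.id_apply]
  let e : F ≃* F := MonoidHom.toMulEquiv (transvection (B j)) (transvection (B j)⁻¹)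
    (comp_eq_id (inv_mul_cancel _) (apply_of_ne _ hij.symm))
    (comp_eq_id (mul_inv_cancel _) (by rw [map_inv, apply_of_ne _ hij.symm]))
  exact ⟨B.map e, apply_self (B j)⟩

lemma IsPartOfBasis.exists_basis_apply_eq_mul {a b : F} (h : IsPartOfBasis a b) :
    ∃ (S : Set F) (B : FreeGroupBasis S F) (s : S), B s = a * b := by
  obtain ⟨S, B, hB, ha, hb, hab⟩ := h
  obtain ⟨B', hB'⟩ :=
    NonEq.exists_basis_apply_eq_mul B (i := ⟨a, ha⟩) (j := ⟨b, hb⟩) (by simpa using hab)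
  exact ⟨S, B', ⟨a, ha⟩, by rw [hB', hB, hB]⟩

end FreeProduct

end NonEq

theorem mainTheorem6_general {G ι F : Type*} [Group G] [Group F] (B : FreeGroupBasis ι F)
    {m n : ℕ} (hm : 4 ≤ m) (hn : 4 ≤ n) :
    (∀ a b : F, NonEq.IsPartOfBasis a b → ∀ u v : Monoid.Coprod G F, ⁅u, v⁆ ≠ 1 →
      Monoid.Coprod.inr a * Monoid.Coprod.inr b ≠ u ^ m * v ^ n) ∧
    (∀ (i : ι) (u v : Monoid.Coprod G F), ⁅u, v⁆ ≠ 1 →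
      Monoid.Coprod.inr (B i) ≠ u ^ m * v ^ n) := by
  simp only [ne_eq, commutatorElement_eq_one_iff_commute]
  refine ⟨fun a b hab u v huv heq => huv ?_, fun i u v huv heq => huv ?_⟩
  · obtain ⟨S, B', s, hs⟩ := hab.exists_basis_apply_eq_mul
    rw [← map_mul, ← hs] at heq
    exact NonEq.commute_of_inr_basis_eq_pow_mul_pow hm hn B' s heq
  · exact NonEq.commute_of_inr_basis_eq_pow_mul_pow hm hn B i heq

theorem mainTheorem6 (G₁ G₂ : Type*) [Group G₁] [Group G₂] [Nontrivial G₁] [Nontrivial G₂]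
    (hne : ¬ (Nonempty (G₁ ≃* Multiplicative (ZMod 2)) ∧
      Nonempty (G₂ ≃* Multiplicative (ZMod 2)))) :
    (∀ a b : NonEq.FOmega, NonEq.IsPartOfBasis a b →
      NonEq.phiNE.Realize
        (![Monoid.Coprod.inr a, Monoid.Coprod.inr b] :
          Fin 2 → Monoid.Coprod (Monoid.Coprod G₁ G₂) NonEq.FOmega)) ∧
    (∀ u v : Monoid.Coprod (Monoid.Coprod G₁ G₂) NonEq.FOmega,
      ⁅u, v⁆ ≠ 1 → Monoid.Coprod.inr NonEq.e₁ ≠ u ^ 5 * v ^ 4) :=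
  have hmain := mainTheorem6_general (FreeGroupBasis.ofFreeGroup ℕ) (Nat.le_succ 4) le_rfl
  ⟨fun a b hab => (NonEq.realize_phiNE _ _).2 (hmain.1 a b hab), hmain.2 0⟩
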